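/- Write $[n]=\{1,\dots,n\}$. For a total order $<_w$ on $[n]$ and two $k$-element subsets $A=\{a_1<_w\dots<_w a_k\}$, $B=\{b_1<_w\dots<_w b_k\}$ of $[n]$, write $A\le_w B$ (Gale order) if $a_s\le_w b_s$ for all $s$. For $i\in[n]$ let $\le_i$ be the Gale order of the cyclic order $i<_i i+1<_i\dots<_i n<_i 1<_i\dots<_i i-1$. For a matroid $M$ on $[n]$ with set of bases $\mathcal B(M)$, the Grassmann necklace $(I_1,\dots,I_n)$ and the Grassmann conecklace $(J_1,\dots,J_n)$ of $M$ are given by $I_i=\min_{\le_i}\mathcal B(M)$ and $J_i=\max_{\le_i}\mathcal B(M)$. A lattice path matroid on $[n]$ is a matroid $M[U,L]$ on $[n]$ whose bases are exactly the sets $B$ with $U\le_1 B\le_1 L$, where $U,L\subseteq[n]$ have the same cardinality and $U\le_1 L$. A Grassmann necklace of type $(k,n)$, $0\le k\le n$, is a sequence $(I_1,\dots,I_n)$ of $k$-element subsets of $[n]$ such that for every $i$ (with $I_{n+1}=I_1$): if $i\in I_i$ then $I_{i+1}=(I_i\setminus\{i\})\cup\{j\}$ for some $j\in[n]$, and if $i\notin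 I_i$ then $I_{i+1}=I_i$. A positroid on $[n]$ is a matroid on $[n]$ whose bases are exactly the $k$-element sets $B\subseteq [n]$ with $I_i\le_i B$ for all $i$, for some Grassmann necklace $(I_1,\dots,I_n)$ of type $(k,n)$. A matroid $M$ is a quotient of a matroid $N$ on the same ground set if every circuit of $N$ is a union of circuits of $M$. Theorem. Let $N'$ and $N$ be lattice path matroids on $[n]$ with Grassmann necklaces $I',I$ and Grassmann conecklaces $J',J$, respectively. Then $N'$ is a quotient of $N$ if and only if $I'_i\subseteq I_i$ and $J'_i\subseteq J_i$ for all $i\in[n]$. In contrast, this fails for general positroids: there are an $n$ and positroids $N'$ and $N$ on $[n]$, with Grassmann necklaces $I',I$ and Grassmann conecklaces $J',J$, such that $I'_i\subseteq I_i$ and $J'_i\subseteq J_i$ for all $i\in[n]$, but $N'$ is not a quotient of $N$. -/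

import Mathlib

/-! ### Gale order -/

/-- The Gale order induced by a total order `w` on `α`: two sets `A = {a₁ <_w ⋯ <_w a_k}` and
`B = {b₁ <_w ⋯ <_w b_k}` of the same finite size satisfy `A ≤ B` when `a_s ≤_w b_s` for all `s`.
Sets of different (or infinite) size are never comparable. -/
def GaleLE {α : Type*} (w : LinearOrder α) (A B : Set α) : Prop :=
  ∃ (k : ℕ) (a b : Fin k → α),
    (∀ s t, s < t → w.lt (a s) (a t)) ∧ Set.range a = A ∧
    (∀ s t, s < t → w.lt (b s) (b t)) ∧ Set.range b = B ∧
    ∀ s, w.le (a s) (b s)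

/-- The cyclic order `i <_i i+1 <_i ⋯ <_i n-1 <_i 0 <_i ⋯ <_i i-1` on `Fin n`
(the subtraction in `Fin n` is modulo `n`). The ground set `[n] = {1, …, n}` is modelled by
`Fin n = {0, …, n-1}`. -/
abbrev cyclicOrder {n : ℕ} (i : Fin n) : LinearOrder (Fin n) :=
  LinearOrder.lift' (fun a : Fin n => a - i) (fun a b h => by
    have : NeZero n := ⟨fun h0 => by subst h0; exact i.elim0⟩
    exact sub_left_injective h)

/-! ### Existence of the Gale-extremal bases of a matroid -/

theorem exists_isBase_forall_galeLE {α : Type*} [Finite α] (w : LinearOrder α) (M : Matroid α) :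
    ∃ A, M.IsBase A ∧ ∀ B, M.IsBase B → GaleLE w A B := by
  classical
  have := Fintype.ofFinite α
  let := w
  let f : α → ℕ := fun e => (Finset.univ.filter (· < e)).card
  have hf : ∀ x y, x < y → f x < f y := by
    intro x y hxy
    apply Finset.card_lt_card
    refine ⟨fun z hz => ?_, fun h => ?_⟩
    · simp only [Finset.mem_filter, Finset.mem_univ, true_and] at hz ⊢
      exact hz.trans hxy
    · have := h (show x ∈ Finset.univ.filter (· < y) by simpa using hxy)
      simp at this
  -- a basis of smallest total weight
  obtain ⟨A, hA, hmin⟩ := Set.exists_min_image {A | M.IsBase A}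
    (fun A => ∑ e ∈ A.toFinset, f e) (Set.toFinite _) M.exists_isBase
  refine ⟨A, hA, fun B hB => ?_⟩
  have hcard : B.toFinset.card = A.toFinset.card := by
    rw [← Set.ncard_eq_toFinset_card', ← Set.ncard_eq_toFinset_card']
    exact hB.ncard_eq_ncard_of_isBase hA
  let a := A.toFinset.orderEmbOfFin rfl
  let b := B.toFinset.orderEmbOfFin hcard
  have ra : Set.range a = A := by simp [a]
  have rb : Set.range b = B := by simp [b]
  refine ⟨_, a, b, fun s t h => a.strictMono h, ra, fun s t h => b.strictMono h, rb, ?_⟩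
  intro s
  by_contra hlt
  replace hlt : b s < a s := not_le.1 hlt
  have hI : M.Indep (a '' Set.Iio s) := hA.indep.subset (by
    exact (Set.image_subset_range _ _).trans ra.subset)
  have hJ : M.Indep (b '' Set.Iic s) := hB.indep.subset (by
    exact (Set.image_subset_range _ _).trans rb.subset)
  have hcd : (a '' Set.Iio s).encard < (b '' Set.Iic s).encard := by
    rw [a.injective.encard_image, b.injective.encard_image]
    apply Set.Finite.encard_lt_encard (Set.toFinite _)
    exact ⟨Set.Iio_subset_Iic_self, fun h => lt_irrefl s (h (Set.mem_Iic.2 (le_refl s)))⟩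
  obtain ⟨e, ⟨heJ, heI⟩, hind⟩ := hI.augment hJ hcd
  have hes : e < a s := by
    obtain ⟨t, ht, rfl⟩ := heJ
    exact lt_of_le_of_lt (b.monotone ht) hlt
  have heA : e ∉ A := by
    intro h
    rw [← ra] at h
    obtain ⟨t, rfl⟩ := h
    exact heI ⟨t, a.lt_iff_lt.1 hes, rfl⟩
  obtain ⟨A', hA', hsub, hsup⟩ := hind.exists_isBase_subset_union_isBase hA
  have heA' : e ∈ A' := hsub (Set.mem_insert _ _)
  have hd : A' \ A = {e} := by
    ext x
    constructor
    · rintro ⟨hx, hxA⟩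
      rcases hsup hx with h | h
      · rcases h with h | ⟨t, -, rfl⟩
        · exact h
        · exact absurd (ra.subset (Set.mem_range_self t)) hxA
      · exact absurd h hxA
    · rintro rfl
      exact ⟨heA', heA⟩
  have hd1 : (A \ A').encard = 1 := by
    rw [hA.encard_sdiff_comm hA', hd, Set.encard_singleton]
  obtain ⟨z, hz⟩ := Set.encard_eq_one.1 hd1
  have hzm : z ∈ A \ A' := hz ▸ Set.mem_singleton z
  have hez : e < z := by
    have hzr := hzm.1
    rw [← ra] at hzr
    obtain ⟨t, rfl⟩ := hzr
    refine lt_of_lt_of_le hes (a.monotone ?_)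
    by_contra hts
    exact hzm.2 (hsub (Set.mem_insert_of_mem _ ⟨t, not_le.1 hts, rfl⟩))
  have h1 := hmin A' hA'
  have e1 : A.toFinset \ A'.toFinset = {z} := by
    rw [← Set.toFinset_sdiff]; simp [hz]
  have e2 : A'.toFinset \ A.toFinset = {e} := by
    rw [← Set.toFinset_sdiff]; simp [hd]
  have s1 := Finset.sum_inter_add_sum_sdiff A.toFinset A'.toFinset f
  have s2 := Finset.sum_inter_add_sum_sdiff A'.toFinset A.toFinset f
  rw [e1, Finset.sum_singleton] at s1
  rw [e2, Finset.sum_singleton, Finset.inter_comm] at s2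
  have := hf e z hez
  omega

theorem exists_isBase_forall_le_gale {α : Type*} [Finite α] (w : LinearOrder α) (M : Matroid α) :
    ∃ A, M.IsBase A ∧ ∀ B, M.IsBase B → GaleLE w B A := by
  obtain ⟨A, hA, h⟩ :=
    exists_isBase_forall_galeLE (letI := w; inferInstanceAs (LinearOrder αᵒᵈ)) M
  refine ⟨A, hA, fun B hB => ?_⟩
  obtain ⟨k, a, b, ha, ra, hb, rb, hab⟩ := h B hB
  refine ⟨k, b ∘ Fin.rev, a ∘ Fin.rev, fun s t hst => hb _ _ (Fin.rev_lt_rev.2 hst), ?_,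
    fun s t hst => ha _ _ (Fin.rev_lt_rev.2 hst), ?_, fun s => hab _⟩
  · rw [Fin.rev_surjective.range_comp, rb]
  · rw [Fin.rev_surjective.range_comp, ra]

/-! ### Grassmann necklaces, conecklaces, positroids -/

/-- The Grassmann necklace of a matroid on `[n]`: its `i`-th entry is the unique basis that is
minimal, among all bases, in the Gale order of the cyclic order `<_i`. -/
noncomputable def grassmannNecklace {n : ℕ} (M : Matroid (Fin n)) (i : Fin n) : Set (Fin n) :=
  (exists_isBase_forall_galeLE (cyclicOrder i) M).choose

/-- The Grassmann conecklace of a matroid on `[n]`: its `i`-th entry is the unique basis that is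
maximal, among all bases, in the Gale order of the cyclic order `<_i`. -/
noncomputable def grassmannConecklace {n : ℕ} (M : Matroid (Fin n)) (i : Fin n) : Set (Fin n) :=
  (exists_isBase_forall_le_gale (cyclicOrder i) M).choose

theorem grassmannNecklace_spec {n : ℕ} (M : Matroid (Fin n)) (i : Fin n) :
    M.IsBase (grassmannNecklace M i) ∧
      ∀ B, M.IsBase B → GaleLE (cyclicOrder i) (grassmannNecklace M i) B :=
  (exists_isBase_forall_galeLE (cyclicOrder i) M).choose_spec

theorem grassmannConecklace_spec {n : ℕ} (M : Matroid (Fin n)) (i : Fin n) :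
    M.IsBase (grassmannConecklace M i) ∧
      ∀ B, M.IsBase B → GaleLE (cyclicOrder i) B (grassmannConecklace M i) :=
  (exists_isBase_forall_le_gale (cyclicOrder i) M).choose_spec

/-- Abstract Grassmann necklaces of type `(k, n)`; `finRotate n i` is the cyclic successor
of `i`. -/
def IsGrassmannNecklace {n : ℕ} (k : ℕ) (I : Fin n → Set (Fin n)) : Prop :=
  k ≤ n ∧ ∀ i, (I i).ncard = k ∧
    (i ∈ I i → ∃ j, I (finRotate n i) = (I i \ {i}) ∪ {j}) ∧
    (i ∉ I i → I (finRotate n i) = I i)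

/-- A positroid on `[n]`: a matroid whose bases are the `k`-element sets `B` with `I_i ≤_i B`
for all `i`, for some Grassmann necklace `I` of type `(k, n)`. -/
def IsPositroid {n : ℕ} (M : Matroid (Fin n)) : Prop :=
  M.E = Set.univ ∧ ∃ (k : ℕ) (I : Fin n → Set (Fin n)), IsGrassmannNecklace k I ∧
    ∀ B, M.IsBase B ↔ B.ncard = k ∧ ∀ i, GaleLE (cyclicOrder i) (I i) B

/-! ### Lattice path matroids and quotients -/

/-- `M` is a lattice path matroid `M[U, L]` on `[n]`: `U ≤ L` in the Gale order of the usual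
order `0 < 1 < ⋯ < n-1`, and the bases of `M` are exactly the sets `B` with `U ≤ B ≤ L`. -/
def IsLatticePathMatroid {n : ℕ} (M : Matroid (Fin n)) : Prop :=
  M.E = Set.univ ∧ ∃ U L : Set (Fin n), GaleLE inferInstance U L ∧
    ∀ B, M.IsBase B ↔ GaleLE inferInstance U B ∧ GaleLE inferInstance B L

/-- `M` is a quotient of `N`: they have the same ground set and every circuit of `N` is the union
of a collection of circuits of `M`. -/
def IsMatroidQuotient {α : Type*} (M N : Matroid α) : Prop :=
  M.E = N.E ∧ ∀ C, N.IsCircuit C → ∃ S : Set (Set α), (∀ D ∈ S, M.IsCircuit D) ∧ ⋃₀ S = C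

/-! ### Quotients, ranks and greedy bases in finite matroids -/

/-! Write `M` for the quotient candidate and `N` for the other matroid. Being a quotient means
`N.closure X ⊆ M.closure X` for every `X`. A greedy description of the extremal bases says that `e`
lies in the `i`-th necklace (conecklace) entry iff `e` is not spanned by the elements before (after)
it in `<_i`. So the necklace inclusions are exactly the closure condition tested on cyclic intervals
next to `e`, and the forward direction is immediate, for arbitrary matroids.

For the converse, let `e` lie in `N.closure X` but not in `M.closure X`. This yields a circuit `C`
of `N` and a cocircuit `D` of `M` with `C ∩ D = {e}`. In a lattice path matroid a circuit spans the
whole interval from its least to its greatest element (`HasHeightBounds.mem_closure_of_isCircuit`);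
the class is closed under duality, so the same holds for `D` in `M✶`. With `P ⊇ C` and `Q ⊇ D` these
intervals, a count (`natRk_add_lt_of_isCircuit_of_isCocircuit`) shows that adding `P` to `Qᶜ` raises
the rank of `M` by more than adding `P ∩ Q` to `P \ Q` raises that of `N`. Submodularity and a chain
of cyclic intervals (`natRk_add_natRk_le_of_chain`) give the opposite inequality.

For positroids, the necklaces see only cyclic intervals, so a failure of closure on a non-interval
such as `{0, 2}` in `Fin 4` goes undetected. -/

theorem isMatroidQuotient_iff_closure_subset {α : Type*} {M N : Matroid α} :
    IsMatroidQuotient M N ↔ M.E = N.E ∧ ∀ X, N.closure X ⊆ M.closure X := by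
  refine and_congr_right fun hE => ⟨fun h X e he => ?_, fun h C hC => ?_⟩
  · have heE := N.mem_ground_of_mem_closure he
    by_cases heX : e ∈ X
    · exact M.mem_closure_of_mem' heX (hE ▸ heE)
    obtain ⟨C, hCX, hC, heC⟩ := (Matroid.mem_closure_iff_exists_isCircuit heX).1 he
    obtain ⟨S, hS, rfl⟩ := h C hC
    obtain ⟨D, hD, heD⟩ := heC
    exact (Matroid.mem_closure_iff_exists_isCircuit heX).2
      ⟨D, (Set.subset_sUnion_of_mem hD).trans hCX, hS D hD, heD⟩
  · refine ⟨{D | M.IsCircuit D ∧ D ⊆ C}, fun D hD => hD.1, ?_⟩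
    refine (Set.sUnion_subset fun D hD => hD.2).antisymm fun e he => ?_
    have := h _ (hC.mem_closure_sdiff_singleton_of_mem he)
    obtain ⟨D, hDC, hD, heD⟩ := (Matroid.mem_closure_iff_exists_isCircuit (by simp)).1 this
    refine ⟨D, ⟨hD, hDC.trans ?_⟩, heD⟩
    simp [he]

/-- The rank of a set in a matroid, as a natural number. -/
noncomputable def natRk {α : Type*} (M : Matroid α) (X : Set α) : ℕ := (M.eRk X).toNat

section natRk

variable {α : Type*} {M : Matroid α} {X Y I C : Set α} {e : α}

theorem natRk_eq_of_subset_of_subset_closure (h : X ⊆ Y) (h' : Y ⊆ M.closure X) :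
    natRk M Y = natRk M X := by
  refine congrArg ENat.toNat (le_antisymm ?_ (M.eRk_mono h))
  exact (M.eRk_mono h').trans (M.eRk_closure_eq X).le

theorem natRk_insert_of_mem_closure (he : e ∈ M.closure X) :
    natRk M (insert e X) = natRk M X := by
  refine congrArg ENat.toNat ?_
  rw [← M.eRk_closure_eq, Matroid.closure_insert_eq_of_mem_closure he, M.eRk_closure_eq]

theorem natRk_empty (M : Matroid α) : natRk M ∅ = 0 := by simp [natRk]

/-- Extend a basis of `X` together with `e` to a basis `B`; the fundamental cocircuit of `e` with
respect to `B` avoids the hyperplane spanned by `B \ {e}`, which contains `X`. -/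
theorem exists_isCocircuit_of_notMem_closure (hE : M.E = Set.univ) (heX : e ∉ X)
    (he : e ∉ M.closure X) : ∃ D, M✶.IsCircuit D ∧ insert e X ∩ D = {e} := by
  obtain ⟨I, hI⟩ := M.exists_isBasis X (by simp [hE])
  have heI : e ∉ M.closure I := by rwa [hI.closure_eq_closure]
  have hins : M.Indep (insert e I) :=
    Matroid.insert_indep_iff.2 ⟨hI.indep, fun _ => ⟨by simp [hE], heI⟩⟩
  obtain ⟨B, hB, hIB⟩ := hins.exists_isBase_superset
  have heB : e ∈ B := hIB (Set.mem_insert _ _)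
  refine ⟨_, hB.compl_closure_sdiff_singleton_isCocircuit heB, ?_⟩
  have hX : X ⊆ M.closure (B \ {e}) := hI.subset_closure.trans <| M.closure_subset_closure
    fun x hx => ⟨hIB (Set.mem_insert_of_mem _ hx), fun h => heX (h ▸ hI.subset hx)⟩
  have := hB.indep.notMem_closure_sdiff_of_mem heB
  ext x
  constructor
  · rintro ⟨rfl | hx, hx'⟩
    · rfl
    · exact absurd (hX hx) hx'.2
  · rintro rfl
    exact ⟨Set.mem_insert _ _, by simp [hE], this⟩

variable [Finite α]

theorem coe_natRk (M : Matroid α) (X : Set α) : (natRk M X : ℕ∞) = M.eRk X := by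
  refine ENat.natCast_toNat ?_
  have h := M.eRk_le_encard X
  exact (h.trans_lt (Set.toFinite X).encard_lt_top).ne

theorem coe_ncard_eq_encard (X : Set α) : (X.ncard : ℕ∞) = X.encard :=
  (Set.toFinite X).cast_ncard_eq

theorem natRk_inter_add_natRk_union_le (M : Matroid α) (X Y : Set α) :
    natRk M (X ∩ Y) + natRk M (X ∪ Y) ≤ natRk M X + natRk M Y := by
  have := M.eRk_inter_add_eRk_union_le X Y
  simp only [← coe_natRk] at this
  exact_mod_cast this

theorem ncard_le_natRk (hI : M.Indep I) (hIX : I ⊆ X) : I.ncard ≤ natRk M X := by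
  have := hI.encard_le_eRk_of_subset hIX
  rw [← coe_natRk, ← coe_ncard_eq_encard] at this
  exact_mod_cast this

theorem natRk_add_one_of_isCircuit (hC : M.IsCircuit C) : natRk M C + 1 = C.ncard := by
  have := hC.eRk_add_one_eq
  rw [← coe_natRk, ← coe_ncard_eq_encard] at this
  exact_mod_cast this

theorem natRk_insert_le (M : Matroid α) (e : α) (X : Set α) :
    natRk M (insert e X) ≤ natRk M X + 1 := by
  have := M.eRk_insert_le_add_one e X
  simp only [← coe_natRk] at this
  exact_mod_cast this

theorem natRk_insert_of_notMem_closure (hE : e ∈ M.E) (he : e ∉ M.closure X) :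
    natRk M (insert e X) = natRk M X + 1 := by
  have := Matroid.eRk_insert_eq_add_one (M := M) (X := X) ⟨hE, he⟩
  simp only [← coe_natRk] at this
  exact_mod_cast this

theorem natRk_dual_add (hE : M.E = Set.univ) (X : Set α) :
    natRk M✶ X + natRk M Set.univ = natRk M Xᶜ + X.ncard := by
  have := M.eRk_dual_add_eRank X (by simp [hE])
  rw [← M.eRk_ground, hE, ← Set.compl_eq_univ_sdiff] at this
  simp only [← coe_natRk, ← coe_ncard_eq_encard] at this
  exact_mod_cast this

/-- Since `C` spans `P`, the rank of `P` is `|C| - 1`, while `C \ Q` is a proper subset of `C`,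
hence independent in `P \ Q`. -/
theorem natRk_add_one_le_of_isCircuit {P Q : Set α} (hC : M.IsCircuit C) (hCP : C ⊆ P)
    (hPC : P ⊆ M.closure C) (h : (C ∩ Q).Nonempty) :
    natRk M P + 1 ≤ natRk M (P \ Q) + (C ∩ Q).ncard := by
  rw [natRk_eq_of_subset_of_subset_closure hCP hPC, natRk_add_one_of_isCircuit hC]
  have hI : M.Indep (C \ Q) := by
    refine hC.ssubset_indep ⟨Set.sdiff_subset, fun h' => ?_⟩
    obtain ⟨e, heC, heQ⟩ := h
    exact (h' heC).2 heQ
  have h1 := ncard_le_natRk hI (Set.sdiff_subset_sdiff_left hCP)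
  have h2 := Set.ncard_inter_add_ncard_sdiff_eq_ncard C Q
  omega

/-- A circuit of `N` and a cocircuit of `M` meeting in one element force a rank increment of `M`
to exceed the corresponding rank increment of `N`. -/
theorem natRk_add_lt_of_isCircuit_of_isCocircuit {N : Matroid α} {D P Q : Set α}
    (hE : M.E = Set.univ) (hC : N.IsCircuit C) (hCP : C ⊆ P) (hPC : P ⊆ N.closure C)
    (hD : M✶.IsCircuit D) (hDQ : D ⊆ Q) (hQD : Q ⊆ M✶.closure D) (hCD : C ∩ D = {e}) :
    natRk N P + natRk M Qᶜ < natRk N (P \ Q) + natRk M (Qᶜ ∪ P) := by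
  have he : e ∈ C ∩ D := hCD ▸ rfl
  have h1 := natRk_add_one_le_of_isCircuit hC hCP hPC ⟨e, he.1, hDQ he.2⟩
  have h2 := natRk_add_one_le_of_isCircuit hD hDQ hQD ⟨e, he.2, hCP he.1⟩
  have h3 := natRk_dual_add hE Q
  have h4 := natRk_dual_add hE (Q \ P)
  rw [Set.compl_sdiff, Set.union_comm] at h4
  have h5 := Set.ncard_inter_add_ncard_sdiff_eq_ncard Q P
  -- Both sets lie in `Q ∩ P` and share at most `e`, so their sizes add up to at most `|Q ∩ P| + 1`.
  -- The circuit and the cocircuit each contribute a `+ 1`, which leaves a strict inequality.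
  have h6 := Set.ncard_union_add_ncard_inter (C ∩ Q) (D ∩ P)
  have h7 : (C ∩ Q ∩ (D ∩ P)).ncard ≤ 1 := by
    rw [← Set.ncard_singleton e, ← hCD]
    exact Set.ncard_le_ncard fun x hx => ⟨hx.1.1, hx.2.1⟩
  have h8 : (C ∩ Q ∪ D ∩ P).ncard ≤ (Q ∩ P).ncard := by
    refine Set.ncard_le_ncard ?_
    rintro x (hx | hx)
    · exact ⟨hx.2, hCP hx.1⟩
    · exact ⟨hDQ hx.1, hx.2⟩
  omega

/-- Along a chain of sets on which closure membership passes from `N` to `M`, the rank of `M`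
increases at most as fast as the rank of `N`. -/
theorem natRk_add_natRk_le_of_chain {N : Matroid α} (hE : N.E = Set.univ) (T : ℕ → Set α)
    {p q : ℕ} (hpq : p ≤ q)
    (hT : ∀ m, p ≤ m → m < q →
      ∃ e, T (m + 1) = insert e (T m) ∧ (e ∈ N.closure (T m) → e ∈ M.closure (T m))) :
    natRk M (T q) + natRk N (T p) ≤ natRk N (T q) + natRk M (T p) := by
  induction q, hpq using Nat.le_induction with
  | base => omega
  | succ m hm ih =>
    have ih := ih fun k h1 h2 => hT k h1 (by omega)
    obtain ⟨e, hTe, he⟩ := hT m hm (by omega)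
    rw [hTe]
    by_cases h : e ∈ N.closure (T m)
    · rw [natRk_insert_of_mem_closure h, natRk_insert_of_mem_closure (he h)]
      exact ih
    · have h1 := natRk_insert_of_notMem_closure (by simp [hE]) h
      have h2 := natRk_insert_le M e (T m)
      omega

theorem closure_inter_eq_of_forall_ncard_le {A D : Set α} (hA : M.IsBase A)
    (h : ∀ B, M.IsBase B → (B ∩ D).ncard ≤ (A ∩ D).ncard) : M.closure (A ∩ D) = M.closure D := by
  have hAD : M.Indep (A ∩ D) := hA.indep.subset Set.inter_subset_left
  obtain ⟨I, hI⟩ := M.exists_isBasis' D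
  obtain ⟨B, hB, hIB⟩ := hI.indep.exists_isBase_superset
  refine (hAD.isBasis'_of_eRk_ge (Set.toFinite _) Set.inter_subset_right ?_).closure_eq_closure
  rw [hAD.eRk_eq_encard, hI.eRk_eq_encard, ← coe_ncard_eq_encard, ← coe_ncard_eq_encard]
  exact_mod_cast (Set.ncard_le_ncard (Set.subset_inter hIB hI.subset)).trans (h B hB)

/-- A basis meeting a set in as many elements as possible spans that set. Thus `A ∩ D` spans `D` and
`A ∩ insert e D` spans `insert e D`; these traces differ exactly when `e ∈ A`. -/
theorem mem_iff_notMem_closure_of_forall_ncard_le {A D : Set α} (hE : M.E = Set.univ)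
    (hA : M.IsBase A) (heD : e ∉ D) (h : ∀ B, M.IsBase B → (B ∩ D).ncard ≤ (A ∩ D).ncard)
    (h' : ∀ B, M.IsBase B → (B ∩ insert e D).ncard ≤ (A ∩ insert e D).ncard) :
    e ∈ A ↔ e ∉ M.closure D := by
  have h1 := closure_inter_eq_of_forall_ncard_le hA h
  have h2 := closure_inter_eq_of_forall_ncard_le hA h'
  constructor
  · intro heA hcl
    rw [← h1] at hcl
    exact hA.indep.notMem_closure_sdiff_of_mem heA <| M.closure_subset_closure
      (show A ∩ D ⊆ A \ {e} from fun x hx => ⟨hx.1, fun hxe => heD (hxe ▸ hx.2)⟩) hcl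
  · intro hcl
    by_contra heA
    rw [Set.inter_insert_of_notMem heA, h1] at h2
    exact hcl (h2 ▸ M.mem_closure_of_mem' (Set.mem_insert e D) (by simp [hE]))

end natRk

/-! ### Counting characterisation of the Gale order -/

theorem GaleLE.ncard_eq {α : Type*} {w : LinearOrder α} {A B : Set α} (h : GaleLE w A B) :
    A.ncard = B.ncard := by
  obtain ⟨k, a, b, ha, rfl, hb, rfl, -⟩ := h
  have ha' : StrictMono a := fun s t => ha s t
  have hb' : StrictMono b := fun s t => hb s t
  rw [Set.ncard_range_of_injective ha'.injective, Set.ncard_range_of_injective hb'.injective]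

theorem GaleLE.ncard_inter_le {α : Type*} {w : LinearOrder α} {A B D : Set α}
    (h : GaleLE w A B) (hD : ∀ x y, w.le x y → y ∈ D → x ∈ D) :
    (B ∩ D).ncard ≤ (A ∩ D).ncard := by
  obtain ⟨k, a, b, ha, rfl, hb, rfl, hab⟩ := h
  have ha' : StrictMono a := fun s t => ha s t
  have hb' : StrictMono b := fun s t => hb s t
  rw [← Set.image_preimage_eq_range_inter, ← Set.image_preimage_eq_range_inter,
    Set.ncard_image_of_injective _ ha'.injective, Set.ncard_image_of_injective _ hb'.injective]
  exact Set.ncard_le_ncard fun s hs => hD _ _ (hab s) hs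

theorem GaleLE.ncard_inter_le_of_upper {α : Type*} {w : LinearOrder α} {A B D : Set α}
    (h : GaleLE w A B) (hD : ∀ x y, w.le x y → x ∈ D → y ∈ D) :
    (A ∩ D).ncard ≤ (B ∩ D).ncard := by
  obtain ⟨k, a, b, ha, rfl, hb, rfl, hab⟩ := h
  have ha' : StrictMono a := fun s t => ha s t
  have hb' : StrictMono b := fun s t => hb s t
  rw [← Set.image_preimage_eq_range_inter, ← Set.image_preimage_eq_range_inter,
    Set.ncard_image_of_injective _ ha'.injective, Set.ncard_image_of_injective _ hb'.injective]
  exact Set.ncard_le_ncard fun s hs => hD _ _ (hab s) hs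

theorem galeLE_iff_ncard_inter_le {α : Type*} [Finite α] {w : LinearOrder α} {A B : Set α} :
    GaleLE w A B ↔ A.ncard = B.ncard ∧
      ∀ x, (B ∩ {y | w.le y x}).ncard ≤ (A ∩ {y | w.le y x}).ncard := by
  refine ⟨fun h => ⟨h.ncard_eq, fun x => h.ncard_inter_le fun y z hyz hz => w.le_trans _ _ _ hyz hz⟩,
    fun ⟨hc, h⟩ => ?_⟩
  classical
  have := Fintype.ofFinite α
  obtain ⟨k, hk⟩ : ∃ k, A.ncard = k := ⟨_, rfl⟩
  have key : ∀ C : Set α, C.ncard = k → ∃ c : Fin k ↪o α, Set.range c = C := fun C hC =>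
    ⟨C.toFinset.orderEmbOfFin (by rw [← hC, Set.ncard_eq_toFinset_card']), by simp⟩
  obtain ⟨a, rfl⟩ := key A hk
  obtain ⟨b, rfl⟩ := key B (hc ▸ hk)
  refine ⟨k, a, b, fun s t h => a.strictMono h, rfl, fun s t h => b.strictMono h, rfl, fun s => ?_⟩
  by_contra hlt
  replace hlt : b s < a s := not_le.1 hlt
  have hs := h (b s)
  rw [← Set.image_preimage_eq_range_inter, ← Set.image_preimage_eq_range_inter,
    Set.ncard_image_of_injective _ a.injective, Set.ncard_image_of_injective _ b.injective] at hs
  -- If `b s < a s`, the prefix ending at `b s` contains `b t` for all `t ≤ s`, but `a t` only for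
  -- some `t < s`.
  refine absurd hs (not_le.2 (Set.ncard_lt_ncard ⟨fun t (ht : a t ≤ b s) => ?_, fun h' => ?_⟩))
  · exact b.monotone (a.lt_iff_lt.1 (lt_of_le_of_lt ht hlt)).le
  · exact not_le.2 hlt (h' (show b s ≤ b s from le_refl _))

theorem mem_iff_notMem_closure_of_forall_galeLE {α : Type*} [Finite α] {w : LinearOrder α}
    {M : Matroid α} {A : Set α} (hE : M.E = Set.univ) (hA : M.IsBase A)
    (h : ∀ B, M.IsBase B → GaleLE w A B) (e : α) :
    e ∈ A ↔ e ∉ M.closure {x | w.lt x e} := by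
  refine mem_iff_notMem_closure_of_forall_ncard_le hE hA (lt_irrefl e)
    (fun B hB => (h B hB).ncard_inter_le fun x y hxy hy => lt_of_le_of_lt hxy hy)
    (fun B hB => (h B hB).ncard_inter_le fun x y hxy hy => ?_)
  rcases hy with rfl | hy
  · exact (lt_or_eq_of_le hxy).symm
  · exact Or.inr (lt_of_le_of_lt hxy hy)

theorem mem_iff_notMem_closure_of_forall_le_gale {α : Type*} [Finite α] {w : LinearOrder α}
    {M : Matroid α} {A : Set α} (hE : M.E = Set.univ) (hA : M.IsBase A)
    (h : ∀ B, M.IsBase B → GaleLE w B A) (e : α) :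
    e ∈ A ↔ e ∉ M.closure {x | w.lt e x} := by
  refine mem_iff_notMem_closure_of_forall_ncard_le hE hA (lt_irrefl e)
    (fun B hB => (h B hB).ncard_inter_le_of_upper fun x y hxy hx => lt_of_lt_of_le hx hxy)
    (fun B hB => (h B hB).ncard_inter_le_of_upper fun x y hxy hx => ?_)
  rcases hx with rfl | hx
  · exact (lt_or_eq_of_le hxy).symm.imp Eq.symm id
  · exact Or.inr (lt_of_lt_of_le hx hxy)

theorem mem_grassmannNecklace_iff {n : ℕ} {M : Matroid (Fin n)} (hE : M.E = Set.univ)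
    (i e : Fin n) : e ∈ grassmannNecklace M i ↔ e ∉ M.closure {x | x - i < e - i} :=
  mem_iff_notMem_closure_of_forall_galeLE hE (grassmannNecklace_spec M i).1
    (grassmannNecklace_spec M i).2 e

theorem mem_grassmannConecklace_iff {n : ℕ} {M : Matroid (Fin n)} (hE : M.E = Set.univ)
    (i e : Fin n) : e ∈ grassmannConecklace M i ↔ e ∉ M.closure {x | e - i < x - i} :=
  mem_iff_notMem_closure_of_forall_le_gale hE (grassmannConecklace_spec M i).1
    (grassmannConecklace_spec M i).2 e

/-! ### Lattice path matroids through height functions -/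

/-- The height of the lattice path of `B` after `t` steps. -/
noncomputable def pathHeight {n : ℕ} (B : Set (Fin n)) (t : ℕ) : ℤ :=
  ((B ∩ {x | x.val < t}).ncard : ℤ)

section pathHeight

variable {n : ℕ} {B C : Set (Fin n)} {x : Fin n} {t : ℕ}

theorem pathHeight_zero (B : Set (Fin n)) : pathHeight B 0 = 0 := by simp [pathHeight]

theorem pathHeight_top (B : Set (Fin n)) : pathHeight B n = B.ncard := by simp [pathHeight]

theorem pathHeight_insert (hx : x ∉ B) (t : ℕ) :
    pathHeight (insert x B) t = pathHeight B t + if x.val < t then 1 else 0 := by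
  unfold pathHeight
  split_ifs with h
  · rw [Set.insert_inter_of_mem (show x ∈ {y : Fin n | y.val < t} from h),
      Set.ncard_insert_of_notMem fun h' => hx h'.1]
    push_cast; rfl
  · rw [Set.insert_inter_of_notMem (show x ∉ {y : Fin n | y.val < t} from h), add_zero]

theorem pathHeight_sdiff_singleton (hx : x ∈ B) (t : ℕ) :
    pathHeight (B \ {x}) t = pathHeight B t - if x.val < t then 1 else 0 := by
  have := pathHeight_insert (B := B \ {x}) (x := x) (by simp) t
  rw [Set.insert_sdiff_singleton, Set.insert_eq_of_mem hx] at this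
  omega

theorem pathHeight_succ_of_mem (hx : x ∈ B) : pathHeight B (x + 1) = pathHeight B x + 1 := by
  unfold pathHeight
  rw [show B ∩ {y | y.val < x.val + 1} = insert x (B ∩ {y | y.val < x.val}) from ?_,
    Set.ncard_insert_of_notMem (by simp)]
  · push_cast; rfl
  · ext y
    simp only [Set.mem_inter_iff, Set.mem_ofPred_eq, Set.mem_insert_iff, Nat.lt_succ_iff_lt_or_eq,
      Fin.ext_iff]
    constructor
    · tauto
    · rintro (h | h)
      · exact ⟨Fin.ext h ▸ hx, Or.inr h⟩
      · tauto

theorem pathHeight_succ_of_notMem (hx : x ∉ B) : pathHeight B (x + 1) = pathHeight B x := by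
  have h1 := pathHeight_succ_of_mem (B := insert x B) (x := x) (Set.mem_insert _ _)
  rw [pathHeight_insert hx, pathHeight_insert hx] at h1
  simpa using h1

theorem pathHeight_mono (B : Set (Fin n)) : Monotone (pathHeight B) := fun s t h =>
  Int.ofNat_le.2 <| Set.ncard_le_ncard <| Set.inter_subset_inter_right _ fun x (hx : x.val < s) =>
    show x.val < t from lt_of_lt_of_le hx h

theorem pathHeight_succ_le (B : Set (Fin n)) (ht : t < n) :
    pathHeight B (t + 1) ≤ pathHeight B t + 1 := by
  by_cases h : (⟨t, ht⟩ : Fin n) ∈ B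
  · exact (pathHeight_succ_of_mem h).le
  · have := pathHeight_succ_of_notMem h
    simp only at this
    omega

theorem pathHeight_compl (B : Set (Fin n)) (ht : t ≤ n) : pathHeight Bᶜ t = t - pathHeight B t := by
  induction t with
  | zero => simp [pathHeight_zero]
  | succ t ih =>
    have ih := ih (by omega)
    by_cases h : (⟨t, ht⟩ : Fin n) ∈ B
    · have h1 := pathHeight_succ_of_mem h
      have h2 := pathHeight_succ_of_notMem (B := Bᶜ) (fun h' => h' h)
      simp only at h1 h2
      push_cast
      omega
    · have h1 := pathHeight_succ_of_notMem h
      have h2 := pathHeight_succ_of_mem (B := Bᶜ) h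
      simp only at h1 h2
      push_cast
      omega

/-- Follow the path of `B` for `t` steps, then the path of `C`. -/
theorem pathHeight_splice (h : pathHeight B t = pathHeight C t) (s : ℕ) :
    pathHeight (B ∩ {x | x.val < t} ∪ C ∩ {x | t ≤ x.val}) s =
      if s ≤ t then pathHeight B s else pathHeight C s := by
  unfold pathHeight at h ⊢
  split_ifs with hs
  · congr 2
    ext x
    simp only [Set.mem_inter_iff, Set.mem_union, Set.mem_ofPred_eq]
    constructor
    · rintro ⟨h | h, h'⟩
      · exact ⟨h.1, h'⟩
      · omega
    · rintro ⟨h, h'⟩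
      exact ⟨Or.inl ⟨h, by omega⟩, h'⟩
  · have key : ∀ D : Set (Fin n), (D ∩ {x | x.val < t} ∪ C ∩ {x | t ≤ x.val}) ∩ {x | x.val < s} =
        D ∩ {x | x.val < t} ∪ C ∩ {x | t ≤ x.val} ∩ {x | x.val < s} := fun D => by
      ext x
      simp only [Set.mem_inter_iff, Set.mem_union, Set.mem_ofPred_eq]
      constructor
      · tauto
      · rintro (h | h)
        · exact ⟨Or.inl h, by omega⟩
        · tauto
    have hC : C = C ∩ {x | x.val < t} ∪ C ∩ {x | t ≤ x.val} := by
      ext x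
      simp only [Set.mem_inter_iff, Set.mem_union, Set.mem_ofPred_eq, ← and_or_left,
        lt_or_ge, and_true]
    have hd : ∀ D : Set (Fin n), Disjoint (D ∩ {x | x.val < t})
        (C ∩ {x | t ≤ x.val} ∩ {x | x.val < s}) := fun D => by
      rw [Set.disjoint_left]
      rintro x ⟨-, h⟩ ⟨⟨-, h'⟩, -⟩
      exact not_lt.2 (show t ≤ x.val from h') h
    conv_rhs => rw [hC]
    rw [key, key, Set.ncard_union_eq (hd B), Set.ncard_union_eq (hd C)]
    push_cast
    rw [h]

end pathHeight

/-- The bases of `M` are the sets whose lattice path stays between the heights `l` and `u`. -/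
structure HasHeightBounds {n : ℕ} (M : Matroid (Fin n)) (l u : ℕ → ℤ) : Prop where
  ground_eq : M.E = Set.univ
  bounds_top : l n = u n
  isBase_iff : ∀ B, M.IsBase B ↔ ∀ t ≤ n, l t ≤ pathHeight B t ∧ pathHeight B t ≤ u t

theorem galeLE_iff_pathHeight_le {n : ℕ} {A B : Set (Fin n)} :
    GaleLE inferInstance A B ↔ A.ncard = B.ncard ∧ ∀ t ≤ n, pathHeight B t ≤ pathHeight A t := by
  rw [galeLE_iff_ncard_inter_le]
  refine and_congr_right fun _ => ⟨fun h t ht => ?_, fun h x => ?_⟩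
  · rcases t with - | t
    · simp [pathHeight_zero]
    · have := h ⟨t, ht⟩
      have e : {y : Fin n | y ≤ ⟨t, ht⟩} = {y | y.val < t + 1} := by
        ext y; simp [Fin.le_def]
      unfold pathHeight
      rw [← e]
      exact_mod_cast this
  · have := h (x.val + 1) x.2
    have e : {y : Fin n | y ≤ x} = {y | y.val < x.val + 1} := by
      ext y; exact (Nat.lt_succ_iff (m := y.val)).symm
    change (B ∩ {y : Fin n | y ≤ x}).ncard ≤ (A ∩ {y : Fin n | y ≤ x}).ncard
    rw [e]
    unfold pathHeight at this
    exact_mod_cast this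

theorem IsLatticePathMatroid.exists_hasHeightBounds {n : ℕ} {M : Matroid (Fin n)}
    (h : IsLatticePathMatroid M) : ∃ l u, HasHeightBounds M l u := by
  obtain ⟨hE, U, L, hUL, hB⟩ := h
  refine ⟨pathHeight L, pathHeight U, hE, ?_, fun B => ?_⟩
  · rw [pathHeight_top, pathHeight_top, hUL.ncard_eq]
  · rw [hB, galeLE_iff_pathHeight_le, galeLE_iff_pathHeight_le]
    constructor
    · exact fun ⟨⟨_, h1⟩, _, h2⟩ t ht => ⟨h2 t ht, h1 t ht⟩
    · intro h
      have h1 := h n le_rfl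
      simp only [pathHeight_top] at h1
      have h2 := hUL.ncard_eq
      exact ⟨⟨by omega, fun t ht => (h t ht).2⟩, by omega, fun t ht => (h t ht).1⟩

namespace HasHeightBounds

variable {n : ℕ} {M : Matroid (Fin n)} {l u : ℕ → ℤ}

theorem dual (h : HasHeightBounds M l u) :
    HasHeightBounds M✶ (fun t => t - u t) (fun t => t - l t) where
  ground_eq := h.ground_eq
  bounds_top := by rw [h.bounds_top]
  isBase_iff B := by
    rw [Matroid.dual_isBase_iff (by simp [h.ground_eq]), h.ground_eq, ← Set.compl_eq_univ_sdiff,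
      h.isBase_iff]
    refine forall₂_congr fun t ht => ?_
    rw [pathHeight_compl B ht]
    omega

/-- In a lattice path matroid a circuit spans the interval between any two of its elements. -/
theorem mem_closure_of_isCircuit (h : HasHeightBounds M l u) {C : Set (Fin n)}
    (hC : M.IsCircuit C) {a b x : Fin n} (ha : a ∈ C) (hb : b ∈ C) (hax : a ≤ x) (hxb : x ≤ b) :
    x ∈ M.closure C := by
  by_contra hx
  have hxC : x ∉ C := fun h' => hx (M.mem_closure_of_mem' h' (by simp [h.ground_eq]))
  have hax : a < x := lt_of_le_of_ne hax fun e => hxC (e ▸ ha)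
  have hxb : x < b := lt_of_le_of_ne hxb fun e => hxC (e ▸ hb)
  -- If `x` is not spanned by `C`, then `C` with any one element `c` replaced by `x` is independent.
  -- The bases obtained for `c = b` and `c = a` are recombined below into a basis containing `C`,
  -- which is absurd.
  have key : ∀ c ∈ C, ∃ B, M.IsBase B ∧ x ∈ B ∧ C \ {c} ⊆ B ∧ c ∉ B := fun c hc => by
    have hI : M.Indep (insert x (C \ {c})) := Matroid.insert_indep_iff.2
      ⟨hC.sdiff_singleton_indep hc, fun _ => ⟨by simp [h.ground_eq],
        by rwa [hC.closure_sdiff_singleton_eq]⟩⟩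
    obtain ⟨B, hB, hIB⟩ := hI.exists_isBase_superset
    refine ⟨B, hB, hIB (Set.mem_insert _ _), (Set.subset_insert _ _).trans hIB, fun hcB => ?_⟩
    refine hC.not_indep (hB.indep.subset fun y hy => ?_)
    by_cases hyc : y = c
    · exact hyc ▸ hcB
    · exact hIB (Or.inr ⟨hy, hyc⟩)
  have contra : ∀ B, C ⊆ B →
      (∀ t ≤ n, l t ≤ pathHeight B t ∧ pathHeight B t ≤ u t) → False := fun B hCB hB =>
    hC.not_indep (((h.isBase_iff B).2 hB).indep.subset hCB)
  obtain ⟨B₁, hB₁, hx₁, hC₁, hb₁⟩ := key b hb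
  obtain ⟨B₂, hB₂, hx₂, hC₂, ha₂⟩ := key a ha
  have hh₁ := (h.isBase_iff B₁).1 hB₁
  have hh₂ := (h.isBase_iff B₂).1 hB₂
  have htop := h.bounds_top
  have hb₂ : b ∈ B₂ := hC₂ ⟨hb, (hax.trans hxb).ne'⟩
  rw [Fin.lt_def] at hax hxb
  rcases le_or_gt (pathHeight B₁ b) (pathHeight B₂ b) with hle | hgt
  -- Just after `b` the path of `B₂` is strictly above that of `B₁`, and both end at the same
  -- height. Let `z` be the step of `B₁` by which it first catches up. Exchanging `z` for `b` raises
  -- `B₁` by one only where it is strictly below `B₂`, so the bounds survive; and `z ∉ B₂` keeps `z`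
  -- out of `C`.
  · have hex : ∃ m, b.val < m ∧ m ≤ n ∧ pathHeight B₂ m ≤ pathHeight B₁ m :=
      ⟨n, b.2, le_rfl, by have := hh₁ n le_rfl; have := hh₂ n le_rfl; omega⟩
    classical
    obtain ⟨hbm, hmn, hm⟩ := Nat.find_spec hex
    have hmin := fun k => Nat.find_min hex (m := k)
    generalize Nat.find hex = m at hbm hmn hm hmin
    have e1 := pathHeight_succ_of_notMem hb₁
    have e2 := pathHeight_succ_of_mem hb₂
    obtain ⟨z, rfl⟩ : ∃ z : Fin n, z.val + 1 = m := ⟨⟨m - 1, by omega⟩, by simp only; omega⟩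
    have hbz : b.val < z.val := by
      rcases eq_or_lt_of_le (Nat.lt_succ_iff.1 hbm) with he | he
      · rw [← he] at hm; omega
      · exact he
    have hlt : ∀ t, b.val < t → t ≤ z.val → pathHeight B₁ t < pathHeight B₂ t := fun t h1 h2 => by
      have := hmin t (by omega)
      by_contra h3
      exact this ⟨h1, by omega, not_lt.1 h3⟩
    have hz := hlt z hbz le_rfl
    have hz₁ : z ∈ B₁ := by
      by_contra hz₁
      have := pathHeight_succ_of_notMem hz₁
      have := pathHeight_mono B₂ (Nat.le_add_right z 1)
      omega
    have hz₂ : z ∉ B₂ := fun hz₂ => by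
      have := pathHeight_succ_of_mem hz₂
      have := pathHeight_succ_of_mem hz₁
      omega
    refine contra (insert b (B₁ \ {z})) (fun c hc => ?_) fun t ht => ?_
    · by_cases hcb : c = b
      · exact Or.inl hcb
      · refine Or.inr ⟨hC₁ ⟨hc, hcb⟩, ?_⟩
        rintro rfl
        exact hz₂ (hC₂ ⟨hc, fun h' => by rw [Set.mem_singleton_iff] at h'; subst h'; omega⟩)
    · rw [pathHeight_insert (fun h' => hb₁ h'.1), pathHeight_sdiff_singleton hz₁]
      have := hh₁ t ht
      have := hh₂ t ht
      have := hlt t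
      split_ifs <;> omega
  -- If `B₁` stays strictly above `B₂` from `x` to `b`, exchanging `x` for `b` lowers it by one only
  -- there.
  · by_cases hall : ∀ t, x.val < t → t ≤ b.val → pathHeight B₂ t < pathHeight B₁ t
    · refine contra (insert b (B₁ \ {x})) (fun c hc => ?_) fun t ht => ?_
      · by_cases hcb : c = b
        · exact Or.inl hcb
        · exact Or.inr ⟨hC₁ ⟨hc, hcb⟩, fun h' => hxC (h' ▸ hc)⟩
      · rw [pathHeight_insert (fun h' => hb₁ h'.1), pathHeight_sdiff_singleton hx₁]
        have := hh₁ t ht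
        have := hh₂ t ht
        have := hall t
        split_ifs <;> omega
    -- Otherwise the paths meet at some `t` with `x < t < b`. Following `B₁` up to `t` and `B₂`
    -- afterwards avoids both defects: `B₁` misses only `b` from `C`, and `B₂` only `a`.
    · push Not at hall
      obtain ⟨s, hxs, hsb, hs⟩ := hall
      have hex : ∃ m, s < m ∧ m ≤ b.val ∧ pathHeight B₂ m < pathHeight B₁ m := by
        refine ⟨b, lt_of_le_of_ne hsb ?_, le_rfl, hgt⟩
        rintro rfl
        omega
      classical
      obtain ⟨hsm, hmb, hm⟩ := Nat.find_spec hex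
      have hmin := fun k => Nat.find_min hex (m := k)
      generalize Nat.find hex = m at hsm hmb hm hmin
      obtain ⟨t, rfl⟩ : ∃ t, m = t + 1 := ⟨m - 1, by omega⟩
      have hst : pathHeight B₁ t ≤ pathHeight B₂ t := by
        by_contra hst
        rcases eq_or_lt_of_le (Nat.lt_succ_iff.1 hsm) with he | he
        · subst he; omega
        · exact hmin t (by omega) ⟨he, by omega, not_le.1 hst⟩
      have htn : t < n := by omega
      have h1 := pathHeight_succ_le B₁ htn
      have h2 := pathHeight_mono B₂ (Nat.le_add_right t 1)
      have heq : pathHeight B₁ t = pathHeight B₂ t := by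
        omega
      refine contra (B₁ ∩ {y | y.val < t} ∪ B₂ ∩ {y | t ≤ y.val}) (fun c hc => ?_) fun r hr => ?_
      · rcases lt_or_ge c.val t with hct | hct
        · exact Or.inl ⟨hC₁ ⟨hc, fun h' => by
            rw [Set.mem_singleton_iff] at h'; subst h'; omega⟩, hct⟩
        · exact Or.inr ⟨hC₂ ⟨hc, fun h' => by
            rw [Set.mem_singleton_iff] at h'; subst h'; omega⟩, hct⟩
      · rw [pathHeight_splice heq]
        split_ifs
        · exact hh₁ r hr
        · exact hh₂ r hr

theorem exists_Icc_of_isCircuit (h : HasHeightBounds M l u) {C : Set (Fin n)}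
    (hC : M.IsCircuit C) : ∃ a b : Fin n, C ⊆ Set.Icc a b ∧ Set.Icc a b ⊆ M.closure C := by
  obtain ⟨a, ha, hamin⟩ := Set.exists_min_image C id (Set.toFinite C) hC.nonempty
  obtain ⟨b, hb, hbmax⟩ := Set.exists_max_image C id (Set.toFinite C) hC.nonempty
  exact ⟨a, b, fun c hc => ⟨hamin c hc, hbmax c hc⟩,
    fun x hx => h.mem_closure_of_isCircuit hC ha hb hx.1 hx.2⟩

end HasHeightBounds

/-! ### Quotients of lattice path matroids -/

theorem Fin.sub_lt_sub_iff_cases {n : ℕ} (i x y : Fin n) :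
    x - i < y - i ↔ (i ≤ x ∧ y < i) ∨ (x < y ∧ (i ≤ x ↔ i ≤ y)) := by
  have key : ∀ z : Fin n, (i ≤ z ∧ (z - i).val = z.val - i.val) ∨
      (z < i ∧ (z - i).val = n + z.val - i.val) := fun z =>
    (le_or_gt i z).imp (fun h => ⟨h, Fin.coe_sub_iff_le.2 h⟩) fun h => ⟨h, Fin.coe_sub_iff_lt.2 h⟩
  have hx := key x
  have hy := key y
  simp only [Fin.le_def, Fin.lt_def] at *
  omega

theorem necklaces_subset_of_isMatroidQuotient {n : ℕ} {M N : Matroid (Fin n)}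
    (hM : M.E = Set.univ) (hN : N.E = Set.univ) (h : IsMatroidQuotient M N) (i : Fin n) :
    grassmannNecklace M i ⊆ grassmannNecklace N i ∧
      grassmannConecklace M i ⊆ grassmannConecklace N i := by
  have hcl := (isMatroidQuotient_iff_closure_subset.1 h).2
  constructor <;> intro e he
  · rw [mem_grassmannNecklace_iff hM] at he
    exact (mem_grassmannNecklace_iff hN i e).2 fun h' => he (hcl _ h')
  · rw [mem_grassmannConecklace_iff hM] at he
    exact (mem_grassmannConecklace_iff hN i e).2 fun h' => he (hcl _ h')

theorem isMatroidQuotient_of_necklaces_subset {n : ℕ} {M N : Matroid (Fin n)} {l u l' u' : ℕ → ℤ}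
    (hM : HasHeightBounds M l' u') (hN : HasHeightBounds N l u)
    (h : ∀ i, grassmannNecklace M i ⊆ grassmannNecklace N i ∧
      grassmannConecklace M i ⊆ grassmannConecklace N i) :
    IsMatroidQuotient M N := by
  have hME := hM.ground_eq
  have hNE := hN.ground_eq
  have hlt : ∀ (i e : Fin n) (T : Set (Fin n)), (∀ x, x ∈ T ↔ x - i < e - i) →
      e ∈ N.closure T → e ∈ M.closure T := fun i e T hT he => by
    obtain rfl : T = {x | x - i < e - i} := Set.ext hT
    by_contra h'
    exact (mem_grassmannNecklace_iff hNE i e).1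
      ((h i).1 ((mem_grassmannNecklace_iff hME i e).2 h')) he
  have hgt : ∀ (i e : Fin n) (T : Set (Fin n)), (∀ x, x ∈ T ↔ e - i < x - i) →
      e ∈ N.closure T → e ∈ M.closure T := fun i e T hT he => by
    obtain rfl : T = {x | e - i < x - i} := Set.ext hT
    by_contra h'
    exact (mem_grassmannConecklace_iff hNE i e).1
      ((h i).2 ((mem_grassmannConecklace_iff hME i e).2 h')) he
  simp only [Fin.sub_lt_sub_iff_cases] at hlt hgt
  rw [isMatroidQuotient_iff_closure_subset]
  refine ⟨hME.trans hNE.symm, fun X e he => ?_⟩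
  by_contra heM
  have heX : e ∉ X := fun h' => heM (M.mem_closure_of_mem' h' (by simp [hME]))
  obtain ⟨C, hCX, hC, heC⟩ := (Matroid.mem_closure_iff_exists_isCircuit heX).1 he
  obtain ⟨D, hD, hXD⟩ := exists_isCocircuit_of_notMem_closure hME heX heM
  have heD : e ∈ D := (hXD.symm.subset rfl).2
  have hCD : C ∩ D = {e} := Set.Subset.antisymm
    ((Set.inter_subset_inter_left D hCX).trans hXD.subset) (by simp [heC, heD])
  obtain ⟨a, b, hCP, hPC⟩ := hN.exists_Icc_of_isCircuit hC
  obtain ⟨c, d, hDQ, hQD⟩ := hM.dual.exists_Icc_of_isCircuit hD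
  have main := natRk_add_lt_of_isCircuit_of_isCocircuit hME hC hCP hPC hD hDQ hQD hCD
  have heP := hCP heC
  have heQ := hDQ heD
  rw [Set.mem_Icc, Fin.le_def, Fin.le_def] at heP heQ
  have hsub := natRk_inter_add_natRk_union_le N (Set.Icc c d)ᶜ (Set.Icc a b)
  rw [Set.inter_comm, ← Set.sdiff_eq] at hsub
  -- The first alternative contradicts `main` through submodularity of `N`. In the second, `Icc a b`
  -- is disjoint from `(Icc c d)ᶜ`, and submodularity of `M` is used instead.
  suffices hinc : natRk M ((Set.Icc c d)ᶜ ∪ Set.Icc a b) + natRk N (Set.Icc c d)ᶜ ≤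
      natRk N ((Set.Icc c d)ᶜ ∪ Set.Icc a b) + natRk M (Set.Icc c d)ᶜ ∨
      (c < a ∧ b < d ∧ natRk M (Set.Icc a b) ≤ natRk N (Set.Icc a b)) by
    rcases hinc with hinc | ⟨hca, hbd, hinc⟩
    · omega
    · have hPQ : Set.Icc a b \ Set.Icc c d = ∅ :=
        Set.sdiff_eq_empty.2 (Set.Icc_subset_Icc hca.le hbd.le)
      have := natRk_inter_add_natRk_union_le M (Set.Icc c d)ᶜ (Set.Icc a b)
      rw [hPQ, natRk_empty] at main
      omega
  rcases le_or_gt a c with hac | hca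
  · left
    rw [Fin.le_def] at hac
    -- Add `c, c + 1, …` to the complement of `Icc c d`: each stage is an initial segment of the
    -- cyclic order starting after `d`, so the necklace applies.
    have := natRk_add_natRk_le_of_chain (M := M) hNE
      (fun m => {x : Fin n | x.val < m ∨ d < x}) (p := c) (q := min b.val d.val + 1) (by omega)
      fun m hcm hm => ⟨⟨m, by omega⟩, ?_, fun hm' => ?_⟩
    · convert this using 3 <;>
      · ext x
        simp only [Set.mem_union, Set.mem_compl_iff, Set.mem_Icc, Set.mem_ofPred_eq, Fin.le_def,
          Fin.lt_def]
        omega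
    · ext x
      simp only [Set.mem_insert_iff, Set.mem_ofPred_eq, Fin.lt_def, Fin.ext_iff]
      omega
    -- The cyclic successor of `d`, wrapping to `0` when `d` is the last element.
    · obtain ⟨i, hi⟩ : ∃ i : Fin n, (d.val + 1 = n ∧ i.val = 0) ∨ i.val = d.val + 1 := by
        by_cases hd : d.val + 1 < n
        · exact ⟨⟨d + 1, hd⟩, Or.inr rfl⟩
        · exact ⟨⟨0, by omega⟩, Or.inl ⟨by omega, rfl⟩⟩
      refine hlt i _ _ (fun x => ?_) hm'
      simp only [Set.mem_ofPred_eq, Fin.lt_def, Fin.le_def]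
      omega
  rcases le_or_gt d b with hdb | hbd
  · left
    rw [Fin.le_def] at hdb
    rw [Fin.lt_def] at hca
    -- Add `d, d - 1, …, a` in descending order: each stage is a final segment of the cyclic order
    -- starting at `c`, so the conecklace applies.
    have := natRk_add_natRk_le_of_chain (M := M) hNE
      (fun m => {x : Fin n | x < c ∨ n ≤ x.val + m}) (p := n - 1 - d) (q := n - a.val) (by omega)
      fun m hcm hm => ⟨⟨n - 1 - m, by omega⟩, ?_, fun hm' => ?_⟩
    · convert this using 3 <;>
      · ext x
        simp only [Set.mem_union, Set.mem_compl_iff, Set.mem_Icc, Set.mem_ofPred_eq, Fin.le_def,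
          Fin.lt_def]
        omega
    · ext x
      simp only [Set.mem_insert_iff, Set.mem_ofPred_eq, Fin.lt_def, Fin.ext_iff]
      omega
    · refine hgt c _ _ (fun x => ?_) hm'
      simp only [Set.mem_ofPred_eq, Fin.lt_def, Fin.le_def]
      omega
  · refine Or.inr ⟨hca, hbd, ?_⟩
    -- Build `Icc a b` from the empty set through initial segments of the cyclic order starting at
    -- `a`.
    have := natRk_add_natRk_le_of_chain (M := M) hNE
      (fun m => {x : Fin n | a ≤ x ∧ x.val < m}) (p := a) (q := b.val + 1) (by omega)
      fun m hcm hm => ⟨⟨m, by omega⟩, ?_, fun hm' => ?_⟩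
    · have e1 : {x : Fin n | a ≤ x ∧ x.val < a.val} = ∅ := by
        refine Set.eq_empty_of_forall_notMem fun x hx => ?_
        simp only [Set.mem_ofPred_eq, Fin.le_def] at hx
        omega
      have e2 : {x : Fin n | a ≤ x ∧ x.val < b.val + 1} = Set.Icc a b := by
        ext x
        simp only [Set.mem_ofPred_eq, Fin.le_def, Set.mem_Icc]
        omega
      rw [e1, e2, natRk_empty, natRk_empty] at this
      exact this
    · ext x
      simp only [Set.mem_insert_iff, Set.mem_ofPred_eq, Fin.le_def, Fin.ext_iff]
      omega
    · refine hlt a _ _ (fun x => ?_) hm'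
      simp only [Set.mem_ofPred_eq, Fin.lt_def, Fin.le_def]
      omega

/-! ### A pair of positroids violating the criterion -/

/-- The matroid on `Fin n` with a prescribed finite collection of bases. -/
noncomputable def matroidOfBases {n : ℕ} (𝓑 : Finset (Finset (Fin n))) (hne : 𝓑.Nonempty)
    (hex : ∀ A ∈ 𝓑, ∀ B ∈ 𝓑, ∀ a ∈ A \ B, ∃ b ∈ B \ A, insert b (A.erase a) ∈ 𝓑) :
    Matroid (Fin n) :=
  Matroid.ofIsBaseOfFinite (E := Set.univ) Set.finite_univ (fun B => ∃ F ∈ 𝓑, ↑F = B)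
    (hne.elim fun F hF => ⟨F, F, hF, rfl⟩)
    (by
      rintro _ _ ⟨A, hA, rfl⟩ ⟨B, hB, rfl⟩ a ha
      obtain ⟨b, hb, h⟩ := hex A hA B hB a (by simpa using ha)
      exact ⟨b, by simpa using hb, _, h, by simp⟩)
    (fun _ _ => Set.subset_univ _)

theorem matroidOfBases_isBase_coe {n : ℕ} {𝓑 : Finset (Finset (Fin n))} {hne hex}
    {F : Finset (Fin n)} : (matroidOfBases 𝓑 hne hex).IsBase ↑F ↔ F ∈ 𝓑 := by
  exact ⟨fun ⟨G, hG, h⟩ => Finset.coe_injective h ▸ hG, fun h => ⟨F, h, rfl⟩⟩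

/-- A decidable form of the cyclic Gale orders. -/
def cyclicGale {n : ℕ} (i : Fin n) (A B : Finset (Fin n)) : Prop :=
  A.card = B.card ∧ ∀ x, (B.filter fun y => y - i ≤ x - i).card ≤
    (A.filter fun y => y - i ≤ x - i).card

instance {n : ℕ} (i : Fin n) (A B : Finset (Fin n)) : Decidable (cyclicGale i A B) := by
  unfold cyclicGale; infer_instance

theorem galeLE_cyclicOrder_coe_iff {n : ℕ} {i : Fin n} {A B : Finset (Fin n)} :
    GaleLE (cyclicOrder i) (A : Set (Fin n)) B ↔ cyclicGale i A B := by
  rw [galeLE_iff_ncard_inter_le, cyclicGale, Set.ncard_coe_finset, Set.ncard_coe_finset]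
  refine and_congr_right fun _ => forall_congr' fun x => ?_
  have key : ∀ F : Finset (Fin n), (↑F ∩ {y | (cyclicOrder i).le y x}).ncard =
      (F.filter fun y => y - i ≤ x - i).card := fun F => by
    rw [← Set.ncard_coe_finset, Finset.coe_filter]
    rfl
  rw [key, key]

theorem isPositroid_matroidOfBases {n k : ℕ} {𝓑 : Finset (Finset (Fin n))} {hne hex}
    (I : Fin n → Finset (Fin n)) (hk : k ≤ n)
    (hI : ∀ i, (I i).card = k ∧ (i ∈ I i → ∃ j, I (finRotate n i) = (I i).erase i ∪ {j}) ∧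
      (i ∉ I i → I (finRotate n i) = I i))
    (h𝓑 : ∀ B, B ∈ 𝓑 ↔ B.card = k ∧ ∀ i, cyclicGale i (I i) B) :
    IsPositroid (matroidOfBases 𝓑 hne hex) := by
  classical
  refine ⟨rfl, k, fun i => I i, ⟨hk, fun i => ⟨?_, fun hi => ?_, fun hi => ?_⟩⟩, fun B => ?_⟩
  · rw [Set.ncard_coe_finset, (hI i).1]
  · obtain ⟨j, hj⟩ := (hI i).2.1 (by simpa using hi)
    refine ⟨j, ?_⟩
    beta_reduce
    rw [hj, Finset.coe_union, Finset.coe_erase, Finset.coe_singleton]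
  · simp only [(hI i).2.2 (by simpa using hi)]
  · lift B to Finset (Fin n) using Set.toFinite B
    simp only [matroidOfBases_isBase_coe, h𝓑, Set.ncard_coe_finset, galeLE_cyclicOrder_coe_iff]

/-- The entry is defined by choice, so only its extremal property is available; in `Finset` form,
inclusions can be decided over all candidates. -/
theorem grassmannNecklace_matroidOfBases {n : ℕ} {𝓑 : Finset (Finset (Fin n))} {hne hex}
    (i : Fin n) : ∃ F ∈ 𝓑, (∀ B ∈ 𝓑, cyclicGale i F B) ∧
      grassmannNecklace (matroidOfBases 𝓑 hne hex) i = ↑F := by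
  obtain ⟨h1, h2⟩ := grassmannNecklace_spec (matroidOfBases 𝓑 hne hex) i
  generalize grassmannNecklace (matroidOfBases 𝓑 hne hex) i = A at h1 h2
  lift A to Finset (Fin n) using Set.toFinite A
  exact ⟨A, matroidOfBases_isBase_coe.1 h1, fun B hB =>
    galeLE_cyclicOrder_coe_iff.1 (h2 B (matroidOfBases_isBase_coe.2 hB)), rfl⟩

theorem grassmannConecklace_matroidOfBases {n : ℕ} {𝓑 : Finset (Finset (Fin n))} {hne hex}
    (i : Fin n) : ∃ F ∈ 𝓑, (∀ B ∈ 𝓑, cyclicGale i B F) ∧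
      grassmannConecklace (matroidOfBases 𝓑 hne hex) i = ↑F := by
  obtain ⟨h1, h2⟩ := grassmannConecklace_spec (matroidOfBases 𝓑 hne hex) i
  generalize grassmannConecklace (matroidOfBases 𝓑 hne hex) i = A at h1 h2
  lift A to Finset (Fin n) using Set.toFinite A
  exact ⟨A, matroidOfBases_isBase_coe.1 h1, fun B hB =>
    galeLE_cyclicOrder_coe_iff.1 (h2 B (matroidOfBases_isBase_coe.2 hB)), rfl⟩

/-- The rank one matroid on `Fin 4` whose loops are `0` and `2`. -/
noncomputable def rankOneOfLoops : Matroid (Fin 4) :=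
  matroidOfBases {{1}, {3}} (by decide) (by decide)

/-- The uniform matroid of rank two on `Fin 4`. -/
noncomputable def uniformTwoFour : Matroid (Fin 4) :=
  matroidOfBases (Finset.univ.powersetCard 2) (by decide) (by decide)

theorem isPositroid_rankOneOfLoops : IsPositroid rankOneOfLoops :=
  isPositroid_matroidOfBases (k := 1) ![{1}, {1}, {3}, {3}] (by decide) (by decide) (by decide)

theorem isPositroid_uniformTwoFour : IsPositroid uniformTwoFour :=
  isPositroid_matroidOfBases (k := 2) ![{0, 1}, {1, 2}, {2, 3}, {3, 0}]
    (by decide) (by decide) (by decide)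

/-- Loops and non-loops alternate, so the first two elements of any cyclic order, which are the
uniform entry, include the first non-loop. -/
theorem grassmannNecklace_rankOneOfLoops_subset (i : Fin 4) :
    grassmannNecklace rankOneOfLoops i ⊆ grassmannNecklace uniformTwoFour i := by
  obtain ⟨F, hF, hF', h1⟩ := grassmannNecklace_matroidOfBases (𝓑 := {{1}, {3}})
    (hne := by decide) (hex := by decide) i
  obtain ⟨G, hG, hG', h2⟩ := grassmannNecklace_matroidOfBases
    (𝓑 := (Finset.univ : Finset (Fin 4)).powersetCard 2) (hne := by decide) (hex := by decide) i
  rw [rankOneOfLoops, uniformTwoFour, h1, h2, Finset.coe_subset]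
  have key : ∀ i : Fin 4, ∀ F ∈ ({{1}, {3}} : Finset (Finset (Fin 4))),
      ∀ G ∈ (Finset.univ : Finset (Fin 4)).powersetCard 2,
      (∀ B ∈ ({{1}, {3}} : Finset (Finset (Fin 4))), cyclicGale i F B) →
      (∀ B ∈ (Finset.univ : Finset (Fin 4)).powersetCard 2, cyclicGale i G B) → F ⊆ G := by
    decide
  exact key i F hF G hG hF' hG'

theorem grassmannConecklace_rankOneOfLoops_subset (i : Fin 4) :
    grassmannConecklace rankOneOfLoops i ⊆ grassmannConecklace uniformTwoFour i := by
  obtain ⟨F, hF, hF', h1⟩ := grassmannConecklace_matroidOfBases (𝓑 := {{1}, {3}})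
    (hne := by decide) (hex := by decide) i
  obtain ⟨G, hG, hG', h2⟩ := grassmannConecklace_matroidOfBases
    (𝓑 := (Finset.univ : Finset (Fin 4)).powersetCard 2) (hne := by decide) (hex := by decide) i
  rw [rankOneOfLoops, uniformTwoFour, h1, h2, Finset.coe_subset]
  have key : ∀ i : Fin 4, ∀ F ∈ ({{1}, {3}} : Finset (Finset (Fin 4))),
      ∀ G ∈ (Finset.univ : Finset (Fin 4)).powersetCard 2,
      (∀ B ∈ ({{1}, {3}} : Finset (Finset (Fin 4))), cyclicGale i B F) →
      (∀ B ∈ (Finset.univ : Finset (Fin 4)).powersetCard 2, cyclicGale i B G) → F ⊆ G := by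
    decide
  exact key i F hF G hG hF' hG'

/-- The set `{0, 2}` spans `uniformTwoFour` but consists of loops of `rankOneOfLoops`, so closure
containment would make `1` a loop. -/
theorem not_isMatroidQuotient_rankOneOfLoops : ¬ IsMatroidQuotient rankOneOfLoops uniformTwoFour := by
  intro h
  have hB : uniformTwoFour.IsBase ({0, 2} : Finset (Fin 4)) :=
    matroidOfBases_isBase_coe.2 (by decide)
  have h1 : rankOneOfLoops.IsBase ({1} : Finset (Fin 4)) := matroidOfBases_isBase_coe.2 (by decide)
  have hloop : (({0, 2} : Finset (Fin 4)) : Set (Fin 4)) ⊆ rankOneOfLoops.closure ∅ := by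
    intro e he
    refine (Matroid.isLoop_iff_forall_notMem_isBase (Set.mem_univ e)).2 fun B hB' heB => ?_
    lift B to Finset (Fin 4) using Set.toFinite B
    have key : ∀ B ∈ ({{1}, {3}} : Finset (Finset (Fin 4))), ∀ e ∈ ({0, 2} : Finset (Fin 4)),
      e ∉ B := by decide
    exact key B (matroidOfBases_isBase_coe.1 hB') e he heB
  have hmem : (1 : Fin 4) ∈ uniformTwoFour.closure ({0, 2} : Finset (Fin 4)) := by
    rw [hB.closure_eq]
    exact Set.mem_univ _
  have hmem' := Matroid.closure_subset_closure_of_subset_closure hloop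
    ((isMatroidQuotient_iff_closure_subset.1 h).2 _ hmem)
  exact (Matroid.isLoop_iff.2 hmem').notMem_of_indep h1.indep (by simp)

theorem theorem5p5 :
    (∀ (n : ℕ) (N' N : Matroid (Fin n)),
      IsLatticePathMatroid N' → IsLatticePathMatroid N →
      (IsMatroidQuotient N' N ↔
        ∀ i : Fin n, grassmannNecklace N' i ⊆ grassmannNecklace N i ∧
          grassmannConecklace N' i ⊆ grassmannConecklace N i)) ∧
    (∃ (n : ℕ) (N' N : Matroid (Fin n)),
      IsPositroid N' ∧ IsPositroid N ∧
      (∀ i : Fin n, grassmannNecklace N' i ⊆ grassmannNecklace N i ∧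
        grassmannConecklace N' i ⊆ grassmannConecklace N i) ∧
      ¬ IsMatroidQuotient N' N) := by
  refine ⟨fun n N' N hN' hN => ⟨necklaces_subset_of_isMatroidQuotient hN'.1 hN.1, fun h => ?_⟩,
    4, rankOneOfLoops, uniformTwoFour, isPositroid_rankOneOfLoops, isPositroid_uniformTwoFour,
    fun i => ⟨grassmannNecklace_rankOneOfLoops_subset i,
      grassmannConecklace_rankOneOfLoops_subset i⟩, not_isMatroidQuotient_rankOneOfLoops⟩
  obtain ⟨l', u', hb'⟩ := hN'.exists_hasHeightBounds
  obtain ⟨l, u, hb⟩ := hN.exists_hasHeightBounds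
  exact isMatroidQuotient_of_necklaces_subset hb' hb h
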